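/- Let $(K,v)$ be a henselian valued field with $\operatorname{char} K=0$ and residue characteristic $p>0$. Write $vK$ for its value group and $Kv$ for its residue field. Assume: - $(K,v)$ is a defectless field, that is, for every finite extension $L|K$ one has $[L:K]=\sum_{i=1}^{g}(v_iL:vK)\,[Lv_i:Kv]$, where $v_1,\dots,v_g$ are the distinct extensions of $v$ to $L$; - $vK$ is $p$-divisible, and $vK=(vK)_{vp}$, where $(vK)_{vp}$ denotes the smallest convex subgroup of $vK$ that contains $vp$; - the residue field $Kv$ is not perfect. Then there is an algebraic extension $(F|K,v)$ of valued fields such that $(F,v)$ is not a defectless field. In fact, $F$ can be chosen so that $(F,v)$ admits a Galois defect extension of degree $p$: there is a Galois extension $L|F$ of degree $p$ to which $v$ extends in a unique way, and for which $[L:F]=p^n\,(vL:vF)\,[Lv:Fv]$ with $p^n>1$. -/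

import Mathlib

/-!
Valued fields. Equivalent valuations are identified, so a valuation of a field `K` is given by its
valuation ring `O : ValuationSubring K`. Its value group `vK`, written multiplicatively, is the
group `O.ValueGroupˣ` of nonzero elements of the group with zero `O.ValueGroup`, and its residue
field `Kv` is `IsLocalRing.ResidueField O`.
-/

universe u

namespace ValuedField

open Module IsLocalRing

variable {K L : Type*} [Field K] [Field L] [Algebra K L]

/-- The valuation of `L` with ring `W` extends the valuation of `K` with ring `O`. -/
def Extends (O : ValuationSubring K) (W : ValuationSubring L) : Prop :=
  W.comap (algebraMap K L) = O

theorem Extends.mem_iff {O : ValuationSubring K} {W : ValuationSubring L} (h : Extends O W)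
    (x : K) : algebraMap K L x ∈ W ↔ x ∈ O := by
  rw [← ValuationSubring.mem_comap, show W.comap (algebraMap K L) = O from h]

/-- The inclusion of valuation rings. -/
def ringMap {O : ValuationSubring K} {W : ValuationSubring L} (h : Extends O W) : O →+* W :=
  (algebraMap K L).restrict O W fun x hx => (h.mem_iff x).2 hx

theorem isLocalHom_ringMap {O : ValuationSubring K} {W : ValuationSubring L} (h : Extends O W) :
    IsLocalHom (ringMap h) := by
  refine ⟨fun a ha => ?_⟩
  obtain ⟨b, hb⟩ := ha.exists_right_inv
  have hb' : algebraMap K L (a : K) * (b : L) = 1 := congrArg Subtype.val hb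
  have hinv : algebraMap K L ((a : K)⁻¹) = b := by
    rw [map_inv₀]
    exact inv_eq_of_mul_eq_one_right hb'
  have ha0 : (a : K) ≠ 0 := by
    intro h0
    rw [h0, map_zero, zero_mul] at hb'
    exact zero_ne_one hb'
  have hmem : (a : K)⁻¹ ∈ O := (h.mem_iff _).1 (hinv ▸ b.2)
  exact IsUnit.of_mul_eq_one ⟨(a : K)⁻¹, hmem⟩ (Subtype.ext (mul_inv_cancel₀ ha0))

/-- The inclusion `Kv → Lv` of residue fields. -/
noncomputable def residueMap {O : ValuationSubring K} {W : ValuationSubring L}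
    (h : Extends O W) : ResidueField O →+* ResidueField W :=
  haveI := isLocalHom_ringMap h
  ResidueField.map (ringMap h)

/-- The inertia degree `[Lv : Kv]`. It is finite whenever `L | K` is finite. -/
noncomputable def inertiaDegree {O : ValuationSubring K} {W : ValuationSubring L}
    (h : Extends O W) : ℕ :=
  letI := (residueMap h).toAlgebra
  finrank (ResidueField O) (ResidueField W)

variable (K) in
/-- The group of values in `vL` of the nonzero elements of `K`, that is, the value group of the
restriction to `K` of the valuation of `L`, as a subgroup of `vL`. -/
noncomputable def valuesOfBase (W : ValuationSubring L) : Subgroup W.ValueGroupˣ :=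
  ((Units.map (W.valuation : L →* W.ValueGroup)).comp
    (Units.map (algebraMap K L : K →* L))).range

variable (K) in
/-- The ramification index `(vL : vK)`. It is finite whenever `L | K` is finite. -/
noncomputable def ramificationIndex (W : ValuationSubring L) : ℕ :=
  (valuesOfBase K W).index

/-- `(K, v)` is a defectless field: for every finite extension `L | K`, equality holds in the
fundamental inequality, `[L : K] = ∑ (vᵢL : vK) [Lvᵢ : Kv]`, where the `vᵢ` are the distinct
extensions of `v` to `L` (there are finitely many of them, so the sum is a finite one). -/
def IsDefectlessField {K : Type u} [Field K] (O : ValuationSubring K) : Prop :=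
  ∀ (L : Type u) [Field L] [Algebra K L] [FiniteDimensional K L],
    finrank K L =
      ∑ᶠ W : {W : ValuationSubring L // Extends O W},
        ramificationIndex K W.1 * inertiaDegree W.2

/-- `(L | K, v)` is unibranched: `W` is the only valuation ring of `L` that extends `O`. -/
def IsUnibranched (O : ValuationSubring K) (W : ValuationSubring L) : Prop :=
  Extends O W ∧ ∀ W' : ValuationSubring L, Extends O W' → W' = W

/-- `(L | K, v)` is a defect extension: it is finite and unibranched and
`[L : K] = q ^ n (vL : vK) [Lv : Kv]` with `q ^ n > 1`, where `q` is the residue characteristic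
exponent of `(K, v)`. The factor `q ^ n` is the defect. -/
def IsDefectExtension (O : ValuationSubring K) (W : ValuationSubring L) : Prop :=
  FiniteDimensional K L ∧ IsUnibranched O W ∧
    ∃ (h : Extends O W) (n : ℕ), 1 < ringExpChar (ResidueField O) ^ n ∧
      finrank K L =
        ringExpChar (ResidueField O) ^ n * (ramificationIndex K W * inertiaDegree h)

/-- The smallest convex subgroup of an ordered abelian group that contains `γ`. -/
def convexSubgroupClosure {Γ : Type*} [CommGroup Γ] [LinearOrder Γ] (γ : Γ) : Subgroup Γ :=
  sInf {H : Subgroup Γ | (H : Set Γ).OrdConnected ∧ γ ∈ H}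

open Classical in
/-- The subgroup `(vK)_{vp}` of `vK`: the smallest convex subgroup that contains `vp` if `p ≠ 0`
in `K`, and `vK` itself otherwise. -/
noncomputable def valueGroupAt (O : ValuationSubring K) (p : ℕ) : Subgroup O.ValueGroupˣ :=
  if hp : (p : K) = 0 then ⊤
  else convexSubgroupClosure (Units.mk0 (O.valuation (p : K)) (O.valuation.ne_zero_iff.2 hp))

end ValuedField

/-! Write `|x|` for the value of `x`, multiplicatively. It suffices to find an algebraic extension
`F` of `K` that contains a primitive `p`-th root of unity `ζ`, and a unit `b` of `O` whose `p`-th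
root `η` has no closest element in `F`. Then `F(η) | F` is Galois of degree `p` by Kummer theory,
and it is immediate. Indeed, its elements are `g(η)` with `deg g < p`, the roots of `g` have degree
less than `p` over `F`, and averaging conjugates shows that each root is farther than `η` from some
element of `F`. So `g(c)` approximates `g(η)` once `c` in `F` is close enough to `η`
(`exists_valuation_aeval_sub_lt`). As `K` is henselian, the valuation extends uniquely, and the
whole degree `p` is defect.

For `F`, let `b` lift a residue that is not a `p`-th power. By `p`-divisibility there are `D_n` in
`K` with `|D_n|^p = |p|^(1 - 1/p^n)`. Put `d_n = D_{n+1}/D_n`, solve `t_0 = b`, `t_{n+1}^p + d_n^p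
t_{n+1} = t_n`, and let `F` be the union of the fields `K(ζ, t_n)`. Modulo `p`, the `p`-th power of
`c_n = D_0 t_1 + ... + D_{n-1} t_n` misses `b` by `D_n^p t_n`. Inside `K(ζ, t_n)` this is optimal: a
better `x` would make the residue of `(x - c_n)/D_n` a `p^(n+1)`-th root of that of `b`, which
forces degree at least `p^(n+1)`, while the field has degree at most `(p-1) p^n`. Since `|D_n|`
decreases, each approximation is beaten at the next stage, but the errors always exceed `|p|`
(`exists_intermediateField_no_best_approximation`). -/

namespace ValuedField

open Module IsLocalRing Polynomial

/-! ### Comparison and existence of extensions of valuations -/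

section Extends

variable {K L M : Type*} [Field K] [Field L] [Field M] [Algebra K L] [Algebra L M] [Algebra K M]

theorem Extends.valuation_le_one_iff {O : ValuationSubring K} {W : ValuationSubring L}
    (h : Extends O W) (x : K) : W.valuation (algebraMap K L x) ≤ 1 ↔ O.valuation x ≤ 1 := by
  rw [W.valuation_le_one_iff, O.valuation_le_one_iff, h.mem_iff]

theorem Extends.valuation_le_iff {O : ValuationSubring K} {W : ValuationSubring L}
    (h : Extends O W) (x y : K) :
    W.valuation (algebraMap K L x) ≤ W.valuation (algebraMap K L y) ↔
      O.valuation x ≤ O.valuation y := by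
  rcases eq_or_ne y 0 with rfl | hy
  · simp
  · have h1 := h.valuation_le_one_iff (x / y)
    have hO : 0 < O.valuation y := O.valuation.pos_iff.2 hy
    have hW : 0 < W.valuation (algebraMap K L y) :=
      W.valuation.pos_iff.2 (by simpa using hy)
    rwa [map_div₀, map_div₀, map_div₀, div_le_one₀ hO, div_le_one₀ hW] at h1

theorem Extends.valuation_lt_iff {O : ValuationSubring K} {W : ValuationSubring L}
    (h : Extends O W) (x y : K) :
    W.valuation (algebraMap K L x) < W.valuation (algebraMap K L y) ↔
      O.valuation x < O.valuation y := by
  rw [← not_le, h.valuation_le_iff, not_le]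

theorem Extends.valuation_eq_iff {O : ValuationSubring K} {W : ValuationSubring L}
    (h : Extends O W) (x y : K) :
    W.valuation (algebraMap K L x) = W.valuation (algebraMap K L y) ↔
      O.valuation x = O.valuation y := by
  rw [le_antisymm_iff, le_antisymm_iff, h.valuation_le_iff, h.valuation_le_iff]

theorem Extends.valuation_lt_one_iff {O : ValuationSubring K} {W : ValuationSubring L}
    (h : Extends O W) (x : K) : W.valuation (algebraMap K L x) < 1 ↔ O.valuation x < 1 := by
  simpa using h.valuation_lt_iff x 1

theorem Extends.trans [IsScalarTower K L M] {O : ValuationSubring K} {W : ValuationSubring L}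
    {V : ValuationSubring M} (h : Extends O W) (h' : Extends W V) : Extends O V := by
  ext x
  rw [ValuationSubring.mem_comap, IsScalarTower.algebraMap_apply K L M, h'.mem_iff, h.mem_iff]

variable (L) in
/-- Every valuation extends to every extension field. -/
theorem exists_extends (O : ValuationSubring K) : ∃ W : ValuationSubring L, Extends O W := by
  obtain ⟨W, hW, hloc⟩ :=
    IsLocalRing.exists_factor_valuationRing ((algebraMap K L).comp O.subtype)
  refine ⟨W, ValuationSubring.ext _ _ fun x => ?_⟩
  rw [ValuationSubring.mem_comap]
  refine ⟨fun hx => ?_, fun hx => hW ⟨x, hx⟩⟩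
  rcases O.mem_or_inv_mem x with h | h
  · exact h
  rcases eq_or_ne x 0 with rfl | hx0
  · exact O.zero_mem
  -- The map from `O` to the valuation ring is local, so it reflects units, and the image of `x⁻¹`
  -- has the inverse `x`.
  have hu : IsUnit (⟨x⁻¹, h⟩ : O) := by
    apply hloc.1
    refine IsUnit.of_mul_eq_one (⟨algebraMap K L x, hx⟩ : W.toSubring) (Subtype.ext ?_)
    change algebraMap K L x⁻¹ * algebraMap K L x = 1
    rw [← map_mul, inv_mul_cancel₀ hx0, map_one]
  obtain ⟨y, hy⟩ := hu.exists_right_inv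
  have hy' : x⁻¹ * (y : K) = 1 := congrArg Subtype.val hy
  have : (y : K) = x := by
    rw [← mul_one x, ← hy', mul_inv_cancel_left₀ hx0]
  exact this ▸ y.2

end Extends

/-! ### Conjugates and minimal polynomials in Galois extensions -/

section Conjugates

variable {K Ω : Type*} [Field K] [Field Ω] [Algebra K Ω]

variable (K) in
theorem exists_finset_conjugates [IsGalois K Ω] (x : Ω) : ∃ R : Finset Ω,
    (∀ y, y ∈ R ↔ ∃ σ : Ω ≃ₐ[K] Ω, σ x = y) ∧
      (minpoly K x).map (algebraMap K Ω) = ∏ r ∈ R, (X - C r) := by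
  classical
  have hx : IsIntegral K x := Algebra.IsIntegral.isIntegral x
  refine ⟨((minpoly K x).aroots Ω).toFinset, fun y => ?_, ?_⟩
  · rw [Multiset.mem_toFinset, ← isConjRoot_iff_mem_minpoly_aroots hx, IsConjRoot.comm,
      isConjRoot_iff_exists_algEquiv]
  · have hs : ((minpoly K x).map (algebraMap K Ω)).Splits := Normal.splits inferInstance x
    have hsep : (minpoly K x).Separable := Algebra.IsSeparable.isSeparable K x
    have hnd : ((minpoly K x).aroots Ω).Nodup := nodup_roots hsep.map
    conv_lhs => rw [hs.eq_prod_roots_of_monic ((minpoly.monic hx).map _)]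
    rw [Finset.prod, Multiset.toFinset_val, hnd.dedup]

/-- The sum of the conjugates of an element lies in the base field. -/
theorem sum_conjugates_mem_range {x : Ω} {R : Finset Ω}
    (hR : (minpoly K x).map (algebraMap K Ω) = ∏ r ∈ R, (X - C r)) :
    ∃ a : K, algebraMap K Ω a = ∑ r ∈ R, r := by
  refine ⟨-(minpoly K x).nextCoeff, ?_⟩
  have h : ((minpoly K x).map (algebraMap K Ω)).nextCoeff = -∑ r ∈ R, r := by
    rw [hR]
    simpa using prod_X_sub_C_nextCoeff (s := R) (fun r : Ω => r)
  rw [map_neg, ← nextCoeff_map (algebraMap K Ω).injective, h, neg_neg]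

/-- If all conjugates of an element lie in the valuation ring, then the minimal polynomial has
coefficients in the valuation ring of the base field. -/
theorem exists_monic_map_eq_minpoly [IsGalois K Ω] {O : ValuationSubring K} {W : ValuationSubring Ω}
    (hW : Extends O W) {x : Ω} (hx : ∀ σ : Ω ≃ₐ[K] Ω, σ x ∈ W) :
    ∃ q : O[X], q.Monic ∧ q.map O.subtype = minpoly K x := by
  obtain ⟨R, hR, hq⟩ := exists_finset_conjugates K x
  have hl : (minpoly K x).map (algebraMap K Ω) ∈ lifts W.subtype := by
    rw [hq]
    refine prod_mem fun r hr => ?_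
    obtain ⟨σ, rfl⟩ := (hR r).1 hr
    exact (mem_lifts _).2 ⟨X - C ⟨σ x, hx σ⟩, by simp⟩
  have hl' : minpoly K x ∈ lifts O.subtype := by
    rw [lifts_iff_coeff_lifts] at hl ⊢
    intro n
    obtain ⟨y, hy⟩ := hl n
    rw [coeff_map] at hy
    exact ⟨⟨(minpoly K x).coeff n, (hW.mem_iff _).1 (hy ▸ y.2)⟩, rfl⟩
  obtain ⟨q, h1, -, h2⟩ := lifts_and_natDegree_eq_and_monic hl'
    (minpoly.monic (Algebra.IsIntegral.isIntegral x))
  exact ⟨q, h2, h1⟩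

end Conjugates

/-! ### From Hensel's lemma to uniqueness of the extended valuation -/

section Henselian

variable {K Ω : Type*} [Field K] [Field Ω] [Algebra K Ω] [IsGalois K Ω]
  {O : ValuationSubring K} {W : ValuationSubring Ω}

/-- The minimal polynomial is `(X - β) h`, where every root of `h` lies in the maximal ideal, so
`h(1)` is a unit. Hence `1` is a simple root of the reduction; Hensel's lemma lifts it to a root in
`K`, and an irreducible polynomial with a root is linear. -/
theorem mem_range_of_valuation_sub_one_lt_one (hO : HenselianLocalRing O) (hW : Extends O W)
    {β : Ω} (hβ1 : W.valuation (1 - β) < 1)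
    (hβ : ∀ σ : Ω ≃ₐ[K] Ω, σ β = β ∨ W.valuation (σ β) < 1) :
    ∃ a : K, algebraMap K Ω a = β := by
  classical
  obtain ⟨R, hR, hP⟩ := exists_finset_conjugates K β
  have hβW : β ∈ W := by
    have : β = 1 - (1 - β) := by ring
    rw [this, ← W.valuation_le_one_iff]
    exact W.valuation.map_sub_le (by simp) hβ1.le
  have hconj : ∀ σ : Ω ≃ₐ[K] Ω, σ β ∈ W := fun σ => by
    rcases hβ σ with h | h
    · rwa [h]
    · exact (W.valuation_le_one_iff _).1 h.le
  obtain ⟨q, hqm, hq⟩ := exists_monic_map_eq_minpoly hW hconj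
  have hβR : β ∈ R := (hR β).2 ⟨AlgEquiv.refl, rfl⟩
  obtain ⟨h, hh⟩ : ∃ h : W[X], h.map W.subtype = ∏ r ∈ R.erase β, (X - C r) := by
    refine (mem_lifts _).1 (prod_mem fun r hr => ?_)
    obtain ⟨σ, rfl⟩ := (hR r).1 (Finset.mem_of_mem_erase hr)
    exact (mem_lifts _).2 ⟨X - C ⟨σ β, hconj σ⟩, by simp⟩
  have hqΩ : q.map ((algebraMap K Ω).comp O.subtype) = (X - C β) * h.map W.subtype := by
    rw [← Polynomial.map_map, hq, hP, hh, Finset.mul_prod_erase R (fun r => X - C r) hβR]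
  have heval : ∀ g : O[X], algebraMap K Ω (g.eval 1 : O) =
      (g.map ((algebraMap K Ω).comp O.subtype)).eval 1 := fun g => by
    rw [eval_map, ← map_one ((algebraMap K Ω).comp O.subtype), eval₂_hom]
    rfl
  have hevalW : ∀ g : W[X], (g.map W.subtype).eval 1 = (g.eval 1 : W) := fun g => by
    rw [eval_map, ← map_one W.subtype, eval₂_hom]
    rfl
  have hle : ∀ y : W, W.valuation (y : Ω) ≤ 1 := fun y => W.valuation_le_one y
  have h1 : W.valuation (algebraMap K Ω (q.eval 1 : O)) < 1 := by
    rw [heval, hqΩ, eval_mul, hevalW, map_mul]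
    refine mul_lt_one_of_lt_of_le ?_ (hle _)
    simpa using hβ1
  have hh1 : W.valuation ((h.eval 1 : W) : Ω) = 1 := by
    rw [← hevalW, hh, eval_prod, map_prod]
    refine Finset.prod_eq_one fun r hr => ?_
    obtain ⟨hne, hr⟩ := Finset.mem_erase.1 hr
    obtain ⟨σ, rfl⟩ := (hR r).1 hr
    have := (hβ σ).resolve_left hne
    rw [eval_sub, eval_X, eval_C, W.valuation.map_sub_eq_of_lt_left (by simpa using this), map_one]
  have h2 : W.valuation (algebraMap K Ω (q.derivative.eval 1 : O)) = 1 := by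
    rw [heval, ← derivative_map, hqΩ, derivative_mul, derivative_map, eval_add, eval_mul, eval_mul,
      hevalW, hevalW, W.valuation.map_add_eq_of_lt_left]
    · simpa using hh1
    · have : W.valuation (eval 1 (X - C β)) * W.valuation ((h.derivative.eval 1 : W) : Ω) < 1 :=
        mul_lt_one_of_lt_of_le (by simpa using hβ1) (hle _)
      simpa [hh1] using this
  obtain ⟨a, ha, -⟩ := hO.is_henselian q hqm 1
    ((O.valuation_lt_one_iff _).2 ((hW.valuation_lt_one_iff _).1 h1))
    ((O.valuation_eq_one_iff _).2 (by
      have := (hW.valuation_eq_iff (q.derivative.eval 1 : O) 1).1 (by simpa using h2)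
      simpa using this))
  have hroot : (minpoly K β).IsRoot (a : K) := by
    rw [← hq]
    exact ha.map (f := O.subtype)
  have hβi : IsIntegral K β := Algebra.IsIntegral.isIntegral β
  exact minpoly.mem_range_of_degree_eq_one K β
    (degree_eq_one_of_irreducible_of_root (minpoly.irreducible hβi) hroot)

/-- Over a henselian field, an element whose value strictly dominates the values of its other
conjugates has no other conjugates. -/
theorem mem_range_of_dominates_conjugates (hO : HenselianLocalRing O) (hW : Extends O W) {β : Ω}
    (hβ0 : β ≠ 0) (hβ : ∀ σ : Ω ≃ₐ[K] Ω, σ β = β ∨ W.valuation (σ β) < W.valuation β) :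
    ∃ a : K, algebraMap K Ω a = β := by
  classical
  obtain ⟨R, hR, hP⟩ := exists_finset_conjugates K β
  have hβR : β ∈ R := (hR β).2 ⟨AlgEquiv.refl, rfl⟩
  obtain ⟨a, ha⟩ := sum_conjugates_mem_range hP
  have hlt : W.valuation (algebraMap K Ω a - β) < W.valuation β := by
    rw [ha, ← Finset.add_sum_erase R (fun r => r) hβR, add_sub_cancel_left]
    refine W.valuation.map_sum_lt (by simpa using hβ0) fun r hr => ?_
    obtain ⟨hne, hr⟩ := Finset.mem_erase.1 hr
    obtain ⟨σ, rfl⟩ := (hR r).1 hr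
    exact (hβ σ).resolve_left hne
  have hva : W.valuation (algebraMap K Ω a) = W.valuation β := by
    rw [← sub_add_cancel (algebraMap K Ω a) β, W.valuation.map_add_eq_of_lt_right hlt]
  have hva0 : 0 < W.valuation (algebraMap K Ω a) := by
    rw [hva]; exact W.valuation.pos_iff.2 hβ0
  have ha0 : algebraMap K Ω a ≠ 0 := W.valuation.pos_iff.1 hva0
  -- `β` dominates the sum `a` of its conjugates, so dividing by `a` reduces to the case of an
  -- element close to `1`.
  obtain ⟨c, hc⟩ := mem_range_of_valuation_sub_one_lt_one hO hW (β := β / algebraMap K Ω a)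
    (by rw [one_sub_div ha0, map_div₀, div_lt_one₀ hva0, hva]; exact hlt)
    (fun σ => by
      rcases hβ σ with h | h
      · left; simp [h]
      · right
        rwa [map_div₀, AlgEquiv.commutes, map_div₀, div_lt_one₀ hva0, hva])
  exact ⟨c * a, by rw [map_mul, hc, div_mul_cancel₀ _ ha0]⟩

/-- Over a henselian field, conjugate elements have the same value. -/
theorem valuation_algEquiv_apply (hO : HenselianLocalRing O) (hW : Extends O W)
    (σ : Ω ≃ₐ[K] Ω) (x : Ω) : W.valuation (σ x) = W.valuation x := by
  classical
  rcases eq_or_ne x 0 with rfl | hx0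
  · simp
  obtain ⟨R, hR, -⟩ := exists_finset_conjugates K x
  have hxR : x ∈ R := (hR x).2 ⟨AlgEquiv.refl, rfl⟩
  have hRσ : ∀ (τ : Ω ≃ₐ[K] Ω), ∀ r ∈ R, τ r ∈ R := fun τ r hr => by
    obtain ⟨ρ, rfl⟩ := (hR r).1 hr
    exact (hR _).2 ⟨ρ.trans τ, rfl⟩
  obtain ⟨y, hy, hmax⟩ := R.exists_max_image W.valuation ⟨x, hxR⟩
  have hy0 : y ≠ 0 := by
    obtain ⟨ρ, rfl⟩ := (hR y).1 hy
    simpa using hx0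
  -- `T` consists of the conjugates of largest value. An automorphism that does not preserve `T`
  -- strictly lowers the value of its product, so this product dominates its other conjugates and
  -- lies in `K`.
  set T := R.filter fun r => W.valuation r = W.valuation y with hT
  have hTR : ∀ r ∈ T, r ∈ R := fun r hr => (Finset.mem_filter.1 hr).1
  have hval : W.valuation (∏ r ∈ T, r) = ∏ r ∈ T, W.valuation y := by
    rw [map_prod]
    exact Finset.prod_congr rfl fun r hr => (Finset.mem_filter.1 hr).2
  have hyval : 0 < W.valuation y := W.valuation.pos_iff.2 hy0
  have hlt : ∀ (τ : Ω ≃ₐ[K] Ω), ∀ r ∈ T, τ r ∉ T →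
      W.valuation (τ (∏ r ∈ T, r)) < W.valuation (∏ r ∈ T, r) := fun τ r hr hτr => by
    rw [hval, map_prod, map_prod]
    have hr' := hRσ τ r (hTR r hr)
    refine Finset.prod_lt_prod (fun i hi => ?_) (fun i hi => hmax _ (hRσ τ i (hTR i hi)))
      ⟨r, hr, lt_of_le_of_ne (hmax _ hr') fun h => hτr (Finset.mem_filter.2 ⟨hr', h⟩)⟩
    obtain ⟨ρ, rfl⟩ := (hR i).1 (hTR i hi)
    exact W.valuation.pos_iff.2 (by simpa using hx0)
  have hβ0 : ∏ r ∈ T, r ≠ 0 := by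
    rw [← W.valuation.pos_iff, hval]
    exact Finset.prod_pos fun _ _ => hyval
  obtain ⟨a, ha⟩ := mem_range_of_dominates_conjugates hO hW hβ0 fun τ => by
    by_cases h : ∀ r ∈ T, τ r ∈ T
    · left
      rw [map_prod]
      refine Finset.prod_nbij τ h (τ.injective.injOn) ?_ fun _ _ => rfl
      exact Finset.surjOn_of_injOn_of_card_le τ h τ.injective.injOn le_rfl
    · push Not at h
      obtain ⟨r, hr, hτr⟩ := h
      exact Or.inr (hlt τ r hr hτr)
  have hyT : y ∈ T := Finset.mem_filter.2 ⟨hy, rfl⟩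
  -- An automorphism taking `y` to some `z` outside `T` would lower the value of the product, which
  -- it fixes.
  have key : ∀ z ∈ R, W.valuation z = W.valuation y := fun z hz => by
    by_contra hne
    obtain ⟨ρ, rfl⟩ := (hR z).1 hz
    obtain ⟨τ, hτ⟩ := (hR y).1 hy
    have := hlt (τ.symm.trans ρ) y hyT (by
      rw [← hτ]
      simpa [hT, hz] using hne)
    rw [← ha, AlgEquiv.commutes] at this
    exact lt_irrefl _ this
  rw [key x hxR, key (σ x) (hRσ σ x hxR)]

/-- A valuation of a henselian field has at most one extension to a Galois extension. -/
theorem extends_unique (hO : HenselianLocalRing O) {W' : ValuationSubring Ω} (hW : Extends O W)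
    (hW' : Extends O W') : W = W' := by
  have key : ∀ {V V' : ValuationSubring Ω}, Extends O V → Extends O V' → V ≤ V' := by
    intro V V' hV hV' x hx
    obtain ⟨q, hqm, hq⟩ := exists_monic_map_eq_minpoly hV (x := x) fun σ => by
      rwa [← V.valuation_le_one_iff, valuation_algEquiv_apply hO hV, V.valuation_le_one_iff]
    have hx' : IsIntegral V' x := by
      refine ⟨q.map (ringMap hV'), hqm.map _, ?_⟩
      rw [eval₂_map]
      have : (algebraMap V' Ω).comp (ringMap hV') = (algebraMap K Ω).comp O.subtype := rfl
      rw [this, ← eval₂_map, hq]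
      exact minpoly.aeval K x
    obtain ⟨y, hy⟩ := IsIntegrallyClosed.isIntegral_iff.1 hx'
    exact hy ▸ y.2
  exact le_antisymm (key hW hW') (key hW' hW)

end Henselian

/-- If `b` is not a `p`-th power in a field of characteristic exponent `p`, then its `p ^ m`-th root
has degree `p ^ m`. -/
theorem pow_le_natDegree_minpoly_of_pow_eq {k l : Type*} [Field k] [Field l] [Algebra k l]
    {p : ℕ} (hp : p.Prime) [ExpChar k p] {b : k} (hb : ∀ c : k, c ^ p ≠ b) {y : l} {m : ℕ}
    (hy : y ^ p ^ m = algebraMap k l b) : p ^ m ≤ (minpoly k y).natDegree := by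
  obtain ⟨n, c, hc⟩ := (minpoly.natSepDegree_eq_one_iff_eq_X_pow_sub_C p).1
    ((minpoly.natSepDegree_eq_one_iff_pow_mem (F := k) (x := y) p).2 ⟨m, b, hy.symm⟩)
  rw [hc, natDegree_X_pow_sub_C]
  by_contra! hlt
  have hnm : n < m := (Nat.pow_lt_pow_iff_right hp.one_lt).1 hlt
  have hyc : y ^ p ^ n = algebraMap k l c := by
    have := minpoly.aeval k y
    rw [hc, map_sub, map_pow, aeval_X, aeval_C] at this
    exact sub_eq_zero.1 this
  -- From `y ^ p ^ n = c` and `n < m` follows `b = c ^ p ^ (m - n)`, a `p`-th power.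
  refine hb (c ^ p ^ (m - n - 1)) ((algebraMap k l).injective ?_)
  rw [← hy, map_pow, map_pow, ← hyc, ← pow_mul, ← pow_mul, ← pow_succ, ← pow_add]
  congr 2
  omega

/-! ### Degree bounds from the residue field -/

section Residue

variable {K L : Type*} [Field K] [Field L] [Algebra K L] {O : ValuationSubring K}
  {W : ValuationSubring L}

/-- A nonzero polynomial over a valued field can be scaled to a polynomial over the valuation ring
whose reduction is not zero. -/
theorem exists_map_eq_C_mul_and_map_residue_ne_zero (O : ValuationSubring K) {f : K[X]}
    (hf : f ≠ 0) :
    ∃ (a : K) (g : O[X]), g.map O.subtype = C a * f ∧ g.map (residue O) ≠ 0 := by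
  obtain ⟨i, hi, hmax⟩ := f.support.exists_max_image (fun j => O.valuation (f.coeff j))
    (support_nonempty.2 hf)
  have hi0 : f.coeff i ≠ 0 := mem_support_iff.1 hi
  have hl : C (f.coeff i)⁻¹ * f ∈ lifts O.subtype := by
    rw [lifts_iff_coeff_lifts]
    intro n
    refine ⟨⟨(C (f.coeff i)⁻¹ * f).coeff n, ?_⟩, rfl⟩
    rw [coeff_C_mul, ← O.valuation_le_one_iff, map_mul, map_inv₀]
    by_cases hn : n ∈ f.support
    · rw [inv_mul_le_one₀ (O.valuation.pos_iff.2 hi0)]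
      exact hmax n hn
    · simp [notMem_support_iff.1 hn]
  obtain ⟨g, hg⟩ := (mem_lifts _).1 hl
  refine ⟨_, g, hg, fun h0 => ?_⟩
  have h1 : g.coeff i = 1 := by
    apply O.subtype_injective
    rw [← coeff_map, hg, coeff_C_mul, inv_mul_cancel₀ hi0, map_one]
  have := congrArg (fun q => q.coeff i) h0
  simp [h1] at this

theorem residueMap_residue (h : Extends O W) (x : O) :
    residueMap h (residue O x) = residue W (ringMap h x) := rfl

/-- The residue of `y` is a `p ^ m`-th root of the residue of `b`, so it has degree at least `p ^ m`
over `Kv`. It is a root of the reduction of a scaled minimal polynomial of `y`. -/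
theorem pow_le_natDegree_minpoly_of_valuation_lt_one (hW : Extends O W) {p : ℕ} (hp : p.Prime)
    [CharP (ResidueField O) p] {b : O} (hb : ∀ c : ResidueField O, c ^ p ≠ residue O b) {y : L}
    (hyK : IsIntegral K y) {m : ℕ}
    (hy : W.valuation (y ^ p ^ m - algebraMap K L b) < 1) :
    p ^ m ≤ (minpoly K y).natDegree := by
  have : ExpChar (ResidueField O) p := ExpChar.prime hp
  have hbW : algebraMap K L b ∈ W := (hW.mem_iff _).2 b.2
  have hyW : y ∈ W := by
    rw [← W.valuation_le_one_iff, ← pow_le_one_iff (n := p ^ m) (pow_pos hp.pos m).ne', ← map_pow,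
      ← sub_add_cancel (y ^ p ^ m) (algebraMap K L b)]
    exact W.valuation.map_add_le hy.le ((W.valuation_le_one_iff _).2 hbW)
  obtain ⟨a, g, hg, hg0⟩ := exists_map_eq_C_mul_and_map_residue_ne_zero O (minpoly.ne_zero hyK)
  let := (residueMap hW).toAlgebra
  have hroot : aeval (residue W ⟨y, hyW⟩) (g.map (residue O)) = 0 := by
    have h1 : (g.map (ringMap hW)).eval ⟨y, hyW⟩ = 0 := by
      apply W.subtype_injective
      rw [← eval_map_apply, Polynomial.map_map]
      have : W.subtype.comp (ringMap hW) = (algebraMap K L).comp O.subtype := rfl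
      rw [this, ← Polynomial.map_map, hg, Polynomial.map_mul, eval_mul]
      have : eval (W.subtype ⟨y, hyW⟩) (map (algebraMap K L) (minpoly K y)) = 0 := by
        rw [eval_map_algebraMap]
        exact minpoly.aeval K y
      rw [this, mul_zero, map_zero]
    have h2 := congrArg (residue W) h1
    rw [map_zero, ← eval_map_apply, Polynomial.map_map] at h2
    rw [aeval_def, eval₂_eq_eval_map, Polynomial.map_map]
    exact h2
  have hpow : (residue W ⟨y, hyW⟩) ^ p ^ m =
      algebraMap (ResidueField O) (ResidueField W) (residue O b) := by
    change _ = residueMap hW (residue O b)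
    rw [residueMap_residue, ← map_pow, ← sub_eq_zero, ← map_sub, residue_eq_zero_iff,
      W.valuation_lt_one_iff]
    exact hy
  calc p ^ m ≤ (minpoly (ResidueField O) (residue W ⟨y, hyW⟩)).natDegree :=
        pow_le_natDegree_minpoly_of_pow_eq hp hb hpow
    _ ≤ (g.map (residue O)).natDegree :=
        natDegree_le_of_dvd (minpoly.dvd _ _ hroot) hg0
    _ ≤ g.natDegree := natDegree_map_le
    _ = (g.map O.subtype).natDegree := (natDegree_map_eq_of_injective O.subtype_injective g).symm
    _ ≤ (minpoly K y).natDegree := hg ▸ natDegree_C_mul_le _ _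

end Residue

/-! ### Approximate additivity of the `p`-th power -/

section Approximation

variable {Ω Γ₀ : Type*} [Field Ω] [LinearOrderedCommGroupWithZero Γ₀] (v : Valuation Ω Γ₀)

theorem valuation_add_pow_sub_le {p : ℕ} (hp : p.Prime) {x y : Ω} (hx : v x ≤ 1) (hy : v y ≤ 1) :
    v ((x + y) ^ p - x ^ p - y ^ p) ≤ v p := by
  obtain ⟨r, hr⟩ := exists_add_pow_prime_eq hp (⟨x, hx⟩ : v.integer) ⟨y, hy⟩
  have hr' := congrArg Subtype.val hr
  push_cast at hr'
  rw [hr']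
  have : x ^ p + y ^ p + p * x * y * (r : Ω) - x ^ p - y ^ p = p * (x * y * r) := by ring
  rw [this, map_mul, map_mul, map_mul]
  exact mul_le_of_le_one_right' (mul_le_one' (mul_le_one' hx hy) r.2)

theorem valuation_pow_sub_pow_lt_one {x y : Ω} (hy : v y ≤ 1) (h : v (x - y) < 1) (k : ℕ) :
    v (x ^ k - y ^ k) < 1 := by
  have hx : v x ≤ 1 := by
    rw [← sub_add_cancel x y]
    exact v.map_add_le h.le hy
  obtain ⟨r, hr⟩ := sub_dvd_pow_sub_pow (⟨x, hx⟩ : v.integer) ⟨y, hy⟩ k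
  have hr' : x ^ k - y ^ k = (x - y) * r := by simpa using congrArg Subtype.val hr
  rw [hr', map_mul]
  exact mul_lt_one_of_lt_of_le h r.2

/-- Modulo `p`, `(x - y) ^ p` agrees with `x ^ p - y ^ p`, and the latter dominates the error by
assumption. -/
theorem valuation_sub_pow_eq {p : ℕ} (hp : p.Prime) {x y : Ω} (hx : v x ≤ 1) (hy : v y ≤ 1)
    (h : v p < v (x ^ p - y ^ p)) : v (x - y) ^ p = v (x ^ p - y ^ p) := by
  have h1 := valuation_add_pow_sub_le v hp hy (v.map_sub_le hx hy)
  rw [add_sub_cancel] at h1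
  have h2 := v.map_sub_eq_of_lt_left (h1.trans_lt h)
  rw [sub_sub_cancel, map_pow] at h2
  exact h2

/-- The partial sums of `D₀ t₁ + D₁ t₂ + ⋯` are approximate `p`-th roots of `t₀`. -/
theorem valuation_sub_sum_pow_sub_le {p : ℕ} (hp : p.Prime) {D d t : ℕ → Ω} (hD0 : D 0 = 1)
    (hD : ∀ n, D (n + 1) = D n * d n) (hDv : ∀ n, v (D n) ≤ 1) (htv : ∀ n, v (t n) ≤ 1)
    (ht : ∀ n, t (n + 1) ^ p + d n ^ p * t (n + 1) = t n) (n : ℕ) :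
    v (∑ i ∈ Finset.range n, D i * t (i + 1)) ≤ 1 ∧
      v (t 0 - (∑ i ∈ Finset.range n, D i * t (i + 1)) ^ p - D n ^ p * t n) ≤ v p := by
  induction n with
  | zero => simp [hD0, hp.ne_zero]
  | succ n ih =>
    rw [Finset.sum_range_succ]
    set c := ∑ i ∈ Finset.range n, D i * t (i + 1)
    have h1 : v (D n * t (n + 1)) ≤ 1 := by
      rw [map_mul]
      exact mul_le_one' (hDv n) (htv _)
    refine ⟨v.map_add_le ih.1 h1, ?_⟩
    have h2 := valuation_add_pow_sub_le v hp ih.1 h1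
    -- By the recursion, `D n ^ p * t n` splits into `(D n * t (n + 1)) ^ p` and the new remainder,
    -- so the only new error is the mixed terms of a `p`-th power.
    have : t 0 - (c + D n * t (n + 1)) ^ p - D (n + 1) ^ p * t (n + 1) =
        (t 0 - c ^ p - D n ^ p * t n) -
          ((c + D n * t (n + 1)) ^ p - c ^ p - (D n * t (n + 1)) ^ p) := by
      rw [← ht n, hD]
      ring
    rw [this]
    exact v.map_sub_le ih.2 h2

end Approximation

/-! ### Degrees in the tower -/

section Tower

variable {K Ω : Type*} [Field K] [Field Ω] [Algebra K Ω]

theorem natDegree_minpoly_le_of_recursion {p : ℕ} (hp : p.Prime) {b : K} {d : ℕ → K} {t : ℕ → Ω}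
    (ht0 : t 0 = algebraMap K Ω b)
    (ht : ∀ n, t (n + 1) ^ p + algebraMap K Ω (d n) ^ p * t (n + 1) = t n) (n : ℕ) :
    (minpoly K (t n)).natDegree ≤ p ^ n := by
  obtain ⟨P, hP, hdeg, hroot⟩ : ∃ P : K[X], P ≠ 0 ∧ P.natDegree = p ^ n ∧ aeval (t n) P = 0 := by
    induction n with
    | zero => exact ⟨X - C b, X_sub_C_ne_zero b, by simp, by simp [ht0]⟩
    | succ n ih =>
      obtain ⟨P, hP, hdeg, hroot⟩ := ih
      have hlt : (C (d n ^ p) * X : K[X]).natDegree < (X ^ p : K[X]).natDegree := by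
        rw [natDegree_X_pow]
        exact (natDegree_C_mul_le _ _ |>.trans natDegree_X_le).trans_lt hp.one_lt
      have hq : (X ^ p + C (d n ^ p) * X : K[X]).natDegree = p := by
        rw [natDegree_add_eq_left_of_natDegree_lt hlt, natDegree_X_pow]
      have hd : (P.comp (X ^ p + C (d n ^ p) * X)).natDegree = p ^ (n + 1) := by
        rw [natDegree_comp, hdeg, hq, pow_succ]
      refine ⟨_, ?_, hd, ?_⟩
      · intro h0
        rw [h0, natDegree_zero] at hd
        exact (pow_pos hp.pos _).ne hd
      · rw [aeval_comp]
        have : aeval (t (n + 1)) (X ^ p + C (d n ^ p) * X) = t n := by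
          rw [← ht n]
          simp
        rw [this, hroot]
  exact hdeg ▸ natDegree_le_of_dvd (minpoly.dvd _ _ hroot) hP

theorem natDegree_minpoly_le_of_isPrimitiveRoot {p : ℕ} (hp : p.Prime) {ζ : Ω}
    (hζ : IsPrimitiveRoot ζ p) : (minpoly K ζ).natDegree ≤ p - 1 := by
  rw [← Nat.totient_prime hp, ← natDegree_cyclotomic p K]
  refine natDegree_le_of_dvd (minpoly.dvd _ _ ?_) (cyclotomic_ne_zero p K)
  rw [aeval_def, eval₂_eq_eval_map, map_cyclotomic]
  exact hζ.isRoot_cyclotomic hp.pos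

/-- Adjoining `ζ` costs a factor of at most `p - 1`, which keeps the degree strictly below the next
power of `p`. -/
theorem natDegree_minpoly_lt_of_mem_sup [Algebra.IsAlgebraic K Ω] {p : ℕ} (hp : p.Prime) {ζ : Ω}
    (hζ : IsPrimitiveRoot ζ p) {x : Ω} {n : ℕ} (hx : (minpoly K x).natDegree ≤ p ^ n) {y : Ω}
    (hy : y ∈ IntermediateField.adjoin K {ζ} ⊔ IntermediateField.adjoin K {x}) :
    (minpoly K y).natDegree < p ^ (n + 1) := by
  have hinteg : ∀ z : Ω, IsIntegral K z := fun z => Algebra.IsIntegral.isIntegral z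
  have := IntermediateField.adjoin.finiteDimensional (hinteg ζ)
  have := IntermediateField.adjoin.finiteDimensional (hinteg x)
  have hfin : FiniteDimensional K
      ↥(IntermediateField.adjoin K {ζ} ⊔ IntermediateField.adjoin K {x}) :=
    IntermediateField.finiteDimensional_sup _ _
  have h1 := minpoly.natDegree_le (A := K) (⟨y, hy⟩ :
    ↥(IntermediateField.adjoin K {ζ} ⊔ IntermediateField.adjoin K {x}))
  rw [IntermediateField.minpoly_eq] at h1
  have h2 := IntermediateField.finrank_sup_le (IntermediateField.adjoin K {ζ})
    (IntermediateField.adjoin K {x})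
  rw [IntermediateField.adjoin.finrank (hinteg ζ), IntermediateField.adjoin.finrank (hinteg x)] at h2
  calc _ ≤ _ := h1
    _ ≤ _ := h2
    _ ≤ (p - 1) * p ^ n := Nat.mul_le_mul (natDegree_minpoly_le_of_isPrimitiveRoot hp hζ) hx
    _ < p * p ^ n := Nat.mul_lt_mul_of_pos_right (Nat.sub_lt hp.pos one_pos) (pow_pos hp.pos n)
    _ = p ^ (n + 1) := (pow_succ' p n).symm

end Tower

/-! ### Construction of the field `F` -/

section Construction

variable {K Ω : Type*} [Field K] [Field Ω] [Algebra K Ω] [IsAlgClosed Ω] [Algebra.IsAlgebraic K Ω]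
  {O : ValuationSubring K} {W : ValuationSubring Ω}

/-- Iterated `p`-th roots, up to units, of an element of a valued field with `p`-divisible value
group. -/
theorem exists_seq_valuation_pow_eq {p : ℕ}
    (hDiv : ∀ γ : O.ValueGroupˣ, ∃ δ : O.ValueGroupˣ, δ ^ p = γ) {a : K} (ha : a ≠ 0) :
    ∃ π : ℕ → K, π 0 = a ∧ (∀ n, π n ≠ 0) ∧
      ∀ n, O.valuation (π (n + 1)) ^ p = O.valuation (π n) := by
  have hstep : ∀ x : {x : K // x ≠ 0}, ∃ y : {y : K // y ≠ 0},
      O.valuation y.1 ^ p = O.valuation x.1 := by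
    intro x
    obtain ⟨δ, hδ⟩ := hDiv (Units.mk0 (O.valuation x.1) (O.valuation.ne_zero_iff.2 x.2))
    obtain ⟨y, hy⟩ := O.valuation_surjective (δ : O.ValueGroup)
    refine ⟨⟨y, ?_⟩, ?_⟩
    · rintro rfl
      exact δ.ne_zero (by rw [← hy, map_zero])
    · rw [hy, ← Units.val_pow_eq_pow_val, hδ, Units.val_mk0]
  choose f hf using hstep
  refine ⟨fun n => (f^[n] ⟨a, ha⟩).1, rfl, fun n => (f^[n] ⟨a, ha⟩).2, fun n => ?_⟩
  simp only [Function.iterate_succ_apply']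
  exact hf _

theorem exists_root_pow_add_mul {p : ℕ} (hp : p.Prime) (e s : Ω) :
    ∃ x : Ω, x ^ p + e * x = s := by
  have hlt : (C e * X - C s : Polynomial Ω).degree < ((p : ℕ) : WithBot ℕ) := by
    refine lt_of_le_of_lt (b := 1) ?_ (by exact_mod_cast hp.one_lt)
    exact (degree_sub_le _ _).trans (max_le (degree_C_mul_X_le e)
      (degree_C_le.trans zero_le_one))
  have hdeg : (X ^ p + (C e * X - C s) : Polynomial Ω).degree ≠ 0 := by
    rw [degree_add_eq_left_of_degree_lt (by rwa [degree_X_pow]), degree_X_pow]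
    exact_mod_cast hp.ne_zero
  obtain ⟨x, hx⟩ := IsAlgClosed.exists_root _ hdeg
  refine ⟨x, ?_⟩
  have : x ^ p + (e * x - s) = 0 := by simpa [IsRoot] using hx
  linear_combination this

/-- A field over which a `p`-th root of `b` has no best approximation. -/
theorem exists_intermediateField_no_best_approximation [CharZero K] (hW : Extends O W) {p : ℕ}
    (hp : p.Prime) [CharP (ResidueField O) p]
    (hDiv : ∀ γ : O.ValueGroupˣ, ∃ δ : O.ValueGroupˣ, δ ^ p = γ)
    {b : O} (hb : ∀ c : ResidueField O, c ^ p ≠ residue O b) :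
    ∃ F : IntermediateField K Ω, (∃ ζ ∈ F, IsPrimitiveRoot ζ p) ∧ ∀ c ∈ F,
      W.valuation (p : Ω) < W.valuation (algebraMap K Ω b - c ^ p) ∧
      ∃ c' ∈ F, W.valuation (algebraMap K Ω b - c' ^ p) <
        W.valuation (algebraMap K Ω b - c ^ p) := by
  have : CharZero Ω := charZero_of_injective_algebraMap (algebraMap K Ω).injective
  have hpK : (p : K) ≠ 0 := Nat.cast_ne_zero.2 hp.ne_zero
  obtain ⟨π, hπ0, hπne, hπ⟩ := exists_seq_valuation_pow_eq hDiv hpK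
  set w := W.valuation
  let a : ℕ → Ω := fun n => algebraMap K Ω (π n)
  have ha0 : a 0 = p := by simp [a, hπ0]
  have hane : ∀ n, a n ≠ 0 := fun n => by simpa [a] using hπne n
  have hapos : ∀ n, 0 < w (a n) := fun n => w.pos_iff.2 (hane n)
  have hapow : ∀ n, w (a (n + 1)) ^ p = w (a n) := fun n => by
    have := (hW.valuation_eq_iff (π (n + 1) ^ p) (π n)).2 (by rw [map_pow, hπ])
    rwa [map_pow, map_pow] at this
  have halt : ∀ n, w (a n) < 1 := by
    intro n
    induction n with
    | zero =>
      refine (hW.valuation_lt_one_iff _).2 ?_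
      rw [hπ0]
      have : ((p : O) : K) = p := by simp
      rw [← this, ← O.valuation_lt_one_iff, ← residue_eq_zero_iff, map_natCast]
      exact CharP.cast_eq_zero _ p
    | succ n ih =>
      rw [← hapow n] at ih
      exact (pow_lt_one_iff hp.ne_zero).1 ih
  have hamono : ∀ n, w (a n) < w (a (n + 1)) := fun n => by
    rw [← hapow n]
    exact pow_lt_self_of_lt_one₀ (hapos _) (halt _) hp.one_lt
  let δ : ℕ → K := fun n => π (n + 1) / π (n + 2)
  let d : ℕ → Ω := fun n => algebraMap K Ω (δ n)
  have hd : ∀ n, d n = a (n + 1) / a (n + 2) := fun n => by simp [d, δ, a]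
  -- `D n` is the product of the first `n` of the `d i`. Since `|a (n + 1)|^p = |a n|` and `a 0 =
  -- p`, one has `|D n|^p = |p| / |a n|`: this decreases with `n` but stays above `|p|`.
  let D : ℕ → Ω := fun n => a 1 / a (n + 1)
  have hDK : ∀ n, D n = algebraMap K Ω (π 1 / π (n + 1)) := fun n => by simp [D, a]
  have hD0 : D 0 = 1 := div_self (hane 1)
  have hDd : ∀ n, D (n + 1) = D n * d n := fun n => by
    rw [hd]
    simp only [D]
    field_simp [hane]
  have hDpos : ∀ n, 0 < w (D n) := fun n => w.pos_iff.2 (div_ne_zero (hane _) (hane _))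
  have hdlt : ∀ n, w (d n) < 1 := fun n => by
    rw [hd, map_div₀, div_lt_one₀ (hapos _)]
    exact hamono _
  have hDlt : ∀ n, w (D (n + 1)) < w (D n) := fun n => by
    rw [hDd, map_mul]
    exact mul_lt_of_lt_one_right (hDpos n) (hdlt n)
  have hDle : ∀ n, w (D n) ≤ 1 := fun n => by
    induction n with
    | zero => simp [hD0]
    | succ n ih => exact (hDlt n).le.trans ih
  have hDp : ∀ n, w p < w (D n) ^ p := fun n => by
    simp only [D]
    rw [map_div₀, div_pow, hapow, hapow, ha0, lt_div_iff₀ (hapos n)]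
    exact mul_lt_of_lt_one_right (ha0 ▸ hapos 0) (halt n)
  -- The linear term leaves a remainder of the form (`p`-th power from `K`) times `t (n + 1)`, to
  -- which the next equation applies. As `|d n| < 1`, the residue of `t (n + 1)` is a `p`-th root of
  -- that of `t n`.
  obtain ⟨t, ht0, ht⟩ : ∃ t : ℕ → Ω, t 0 = algebraMap K Ω b ∧
      ∀ n, t (n + 1) ^ p + d n ^ p * t (n + 1) = t n := by
    choose f hf using fun (n : ℕ) (s : Ω) => exists_root_pow_add_mul hp (d n ^ p) s
    exact ⟨fun n => Nat.rec (algebraMap K Ω b) f n, rfl, fun n => hf n _⟩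
  have htv : ∀ n, w (t n) ≤ 1 := fun n => by
    induction n with
    | zero =>
      rw [ht0]
      exact (W.valuation_le_one_iff _).2 ((hW.mem_iff _).2 b.2)
    | succ n ih =>
      by_contra! h
      have h1 : w (d n ^ p * t (n + 1)) < w (t (n + 1) ^ p) := by
        rw [map_mul, map_pow, map_pow]
        calc w (d n) ^ p * w (t (n + 1)) < 1 * w (t (n + 1)) := by
              refine mul_lt_mul_of_pos_right ?_ (zero_lt_one.trans h)
              exact (pow_lt_one_iff hp.ne_zero).2 (hdlt n)
          _ ≤ w (t (n + 1)) ^ p := by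
              rw [one_mul]
              exact le_self_pow₀ h.le hp.ne_zero
      have h2 := w.map_add_eq_of_lt_left h1
      rw [ht, map_pow] at h2
      exact absurd ih (not_le.2 (h2 ▸ one_lt_pow₀ h hp.ne_zero))
  have htpow : ∀ n, w (t (n + 1) ^ p - t n) < 1 := fun n => by
    have : t (n + 1) ^ p - t n = -(d n ^ p * t (n + 1)) := by
      linear_combination ht n
    rw [this, Valuation.map_neg, map_mul, map_pow]
    exact mul_lt_one_of_lt_of_le ((pow_lt_one_iff hp.ne_zero).2 (hdlt n)) (htv _)
  have htb : ∀ n, w (t n ^ p ^ n - algebraMap K Ω b) < 1 := fun n => by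
    induction n with
    | zero => simp [ht0]
    | succ n ih =>
      have h1 := valuation_pow_sub_pow_lt_one w (htv n) (htpow n) (p ^ n)
      rw [← pow_mul, ← pow_succ'] at h1
      have := w.map_add_lt h1 ih
      rwa [sub_add_sub_cancel] at this
  obtain ⟨ζ, hζ⟩ : ∃ ζ : Ω, IsPrimitiveRoot ζ p := by
    have : NeZero (p : Ω) := ⟨Nat.cast_ne_zero.2 hp.ne_zero⟩
    exact HasEnoughRootsOfUnity.exists_primitiveRoot Ω p
  let E : ℕ → IntermediateField K Ω := fun n =>
    IntermediateField.adjoin K {ζ} ⊔ IntermediateField.adjoin K {t n}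
  have htE : ∀ n, t n ∈ E n := fun n =>
    (le_sup_right : _ ≤ E n) (IntermediateField.mem_adjoin_simple_self K _)
  have hζE : ∀ n, ζ ∈ E n := fun n =>
    (le_sup_left : _ ≤ E n) (IntermediateField.mem_adjoin_simple_self K _)
  have hEmono : Monotone E := monotone_nat_of_le_succ fun n => by
    refine sup_le le_sup_left (IntermediateField.adjoin_simple_le_iff.2 ?_)
    rw [← ht n]
    exact add_mem (pow_mem (htE _) p) (mul_mem (pow_mem ((E _).algebraMap_mem _) p) (htE _))
  let c : ℕ → Ω := fun n => ∑ i ∈ Finset.range n, D i * t (i + 1)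
  have hcE : ∀ n, c n ∈ E n := fun n => sum_mem fun i hi => by
    refine mul_mem (hDK i ▸ (E n).algebraMap_mem _) ?_
    exact hEmono (Nat.succ_le_of_lt (Finset.mem_range.1 hi)) (htE _)
  have hc := valuation_sub_sum_pow_sub_le w hp hD0 hDd hDle htv ht
  -- Up to errors of value at most `|p| < |D n|^p`, a better `x` would satisfy `(x - c n) ^ p = D n
  -- ^ p * t n`, so `(x - c n) / D n` would be a residual `p ^ (n + 1)`-th root of `b` inside `E n`,
  -- contrary to the degree bounds.
  have hlow : ∀ n, ∀ x ∈ E n, w (D n) ^ p ≤ w (algebraMap K Ω b - x ^ p) := by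
    intro n x hx
    by_contra! hlt
    have hx1 : w x ≤ 1 := by
      rw [← pow_le_one_iff hp.ne_zero, ← map_pow, ← sub_sub_cancel (algebraMap K Ω b) (x ^ p)]
      exact w.map_sub_le (ht0 ▸ htv 0) (hlt.le.trans ((pow_le_one_iff hp.ne_zero).2 (hDle n)))
    have h1 := valuation_add_pow_sub_le w hp (hc n).1 (w.map_sub_le hx1 (hc n).1)
    rw [add_sub_cancel] at h1
    have h2 : w ((x - c n) ^ p - D n ^ p * t n) < w (D n) ^ p := by
      have : (x - c n) ^ p - D n ^ p * t n = (t 0 - c n ^ p - D n ^ p * t n) -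
          (t 0 - x ^ p) - (x ^ p - c n ^ p - (x - c n) ^ p) := by ring
      rw [this, ht0]
      exact w.map_sub_lt (w.map_sub_lt (ht0 ▸ (hc n).2.trans_lt (hDp n)) hlt)
        (h1.trans_lt (hDp n))
    have hDne : D n ≠ 0 := w.pos_iff.1 (hDpos n)
    have h3 : w (((x - c n) / D n) ^ p - t n) < 1 := by
      have : ((x - c n) / D n) ^ p - t n = ((x - c n) ^ p - D n ^ p * t n) / D n ^ p := by
        rw [div_pow, sub_div, mul_div_cancel_left₀ _ (pow_ne_zero p hDne)]
      rwa [this, map_div₀, map_pow, div_lt_one₀ (pow_pos (hDpos n) p)]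
    have h4 := valuation_pow_sub_pow_lt_one w (htv n) h3 (p ^ n)
    rw [← pow_mul, ← pow_succ'] at h4
    have h5 := w.map_add_lt h4 (htb n)
    rw [sub_add_sub_cancel] at h5
    have h6 : (x - c n) / D n ∈ E n :=
      div_mem (sub_mem hx (hcE n)) (hDK n ▸ (E n).algebraMap_mem _)
    exact absurd (pow_le_natDegree_minpoly_of_valuation_lt_one hW hp hb
      (Algebra.IsIntegral.isIntegral _) h5) (not_le.2 (natDegree_minpoly_lt_of_mem_sup hp hζ
        (natDegree_minpoly_le_of_recursion hp ht0 ht n) h6))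
  have hupp : ∀ n, w (algebraMap K Ω b - c n ^ p) ≤ w (D n) ^ p := fun n => by
    rw [← ht0, ← sub_add_cancel (t 0 - c n ^ p) (D n ^ p * t n)]
    refine w.map_add_le ((hc n).2.trans (hDp n).le) ?_
    rw [map_mul, map_pow]
    exact mul_le_of_le_one_right' (htv n)
  refine ⟨⨆ n, E n, ⟨ζ, (le_iSup E 0) (hζE 0), hζ⟩, fun x hx => ?_⟩
  have hx' : x ∈ ((⨆ n, E n : IntermediateField K Ω) : Set Ω) := hx
  rw [IntermediateField.coe_iSup_of_directed hEmono.directed_le, Set.mem_iUnion] at hx'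
  obtain ⟨n, hn⟩ := hx'
  -- The error of `c (n + 1)` is at most `|D (n + 1)|^p`, strictly below the bound `|D n|^p` valid
  -- on all of `E n`.
  refine ⟨(hDp n).trans_le (hlow n x hn), c (n + 1), (le_iSup E (n + 1)) (hcE _), ?_⟩
  exact (hupp (n + 1)).trans_lt (lt_of_lt_of_le
    (pow_lt_pow_left₀ (hDlt n) zero_le hp.ne_zero) (hlow n x hn))

end Construction

/-! ### Polynomial values at an element without best approximation -/

section Immediate

variable {F Ω Γ₀ : Type*} [Field F] [Field Ω] [Algebra F Ω] [LinearOrderedCommGroupWithZero Γ₀]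
  {v : Valuation Ω Γ₀} {η : Ω}

/-- If the `p`-th power of an integral element `η` has no best approximation by `p`-th powers, and
these approximations are not too good, then `η` has no best approximation. -/
theorem exists_valuation_sub_lt_of_pow {S : Type*} [SetLike S Ω] [ZeroMemClass S Ω]
    (v : Valuation Ω Γ₀) {p : ℕ} (hp : p.Prime) {F : S} (hηv : v η ≤ 1)
    (hF : ∀ c ∈ F, v (p : Ω) < v (η ^ p - c ^ p) ∧ ∃ c' ∈ F, v (η ^ p - c' ^ p) < v (η ^ p - c ^ p))
    (c : F) : ∃ c' : F, v (η - c') < v (η - c) := by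
  -- A non-integral `c` is improved by `0`. For integral ones, distances to `η` are compared through
  -- their `p`-th powers.
  rcases lt_or_ge 1 (v (c : Ω)) with hc | hc
  · refine ⟨⟨0, zero_mem F⟩, ?_⟩
    rw [sub_zero, v.map_sub_eq_of_lt_right (hηv.trans_lt hc)]
    exact hηv.trans_lt hc
  · obtain ⟨h1, c', hc'F, hlt⟩ := hF c c.2
    have hpow : ∀ {x : Ω}, v x ≤ 1 → v (x ^ p) ≤ 1 := fun hx => by
      rwa [map_pow, pow_le_one_iff hp.ne_zero]
    have hc' : v c' ≤ 1 := by
      rw [← pow_le_one_iff hp.ne_zero, ← map_pow, ← sub_sub_cancel (η ^ p) (c' ^ p)]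
      exact v.map_sub_le (hpow hηv) (hlt.le.trans (v.map_sub_le (hpow hηv) (hpow hc)))
    refine ⟨⟨c', hc'F⟩, lt_of_pow_lt_pow_left₀ p zero_le ?_⟩
    rwa [valuation_sub_pow_eq v hp hηv hc h1, valuation_sub_pow_eq v hp hηv hc' (hF c' hc'F).1]

/-- If `η` has no best approximation in `F`, then elements of degree less than the residue
characteristic are farther than `η` from a suitable element of `F`. -/
theorem exists_valuation_sub_lt_of_natDegree_lt [IsGalois F Ω]
    (hv : ∀ (σ : Ω ≃ₐ[F] Ω) (x : Ω), v (σ x) = v x) {p : ℕ}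
    (hp : ∀ m : ℕ, m ≠ 0 → m < p → v m = 1)
    (hη : ∀ c : F, ∃ c' : F, v (η - algebraMap F Ω c') < v (η - algebraMap F Ω c))
    {θ : Ω} (hθ : (minpoly F θ).natDegree < p) :
    ∃ c : F, v (η - algebraMap F Ω c) < v (θ - algebraMap F Ω c) := by
  by_contra! hle
  obtain ⟨R, hR, hP⟩ := exists_finset_conjugates F θ
  obtain ⟨a, ha⟩ := sum_conjugates_mem_range hP
  have hcard : (minpoly F θ).natDegree = R.card := by
    rw [← natDegree_map (algebraMap F Ω), hP, natDegree_finsetProd_X_sub_C_eq_card]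
  have hcard0 : R.card ≠ 0 :=
    Finset.card_ne_zero_of_mem ((hR θ).2 ⟨AlgEquiv.refl, rfl⟩)
  have hm : v (R.card : Ω) = 1 := hp _ hcard0 (hcard ▸ hθ)
  have hm0 : (R.card : Ω) ≠ 0 := v.ne_zero_iff.1 (by simp [hm])
  have key : ∀ c : F, v (algebraMap F Ω (a / R.card) - algebraMap F Ω c) ≤
      v (η - algebraMap F Ω c) := fun c => by
    -- `a / R.card` is the average of the conjugates of `θ`; their number is a unit since it is less
    -- than `p`. If `θ` were never farther than `η` from any `c`, neither would this average be, and
    -- it would be a best approximation of `η` in `F`.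
    have h1 : (R.card : Ω) * (algebraMap F Ω (a / R.card) - algebraMap F Ω c) =
        ∑ r ∈ R, (r - algebraMap F Ω c) := by
      rw [Finset.sum_sub_distrib, ← ha, Finset.sum_const, nsmul_eq_mul, map_div₀, map_natCast,
        mul_sub, mul_div_cancel₀ _ hm0]
    have h2 := congrArg v h1
    rw [map_mul, hm, one_mul] at h2
    rw [h2]
    refine v.map_sum_le fun r hr => ?_
    obtain ⟨σ, rfl⟩ := (hR r).1 hr
    have h3 : σ θ - algebraMap F Ω c = σ (θ - algebraMap F Ω c) := by
      rw [map_sub, σ.commutes]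
    rw [h3, hv]
    exact hle c
  obtain ⟨c', hc'⟩ := hη (a / R.card)
  refine absurd hc' (not_lt.2 ?_)
  rw [← sub_sub_sub_cancel_right η _ (algebraMap F Ω c')]
  exact v.map_sub_le le_rfl (key c')

/-- A `c` that works for `θ` can be replaced by any element at least as close to `η`, since this
leaves the distance from `θ` unchanged. So the closest of finitely many choices works for all. -/
theorem exists_forall_valuation_sub_lt (s : Finset Ω)
    (hs : ∀ θ ∈ s, ∃ c : F, v (η - algebraMap F Ω c) < v (θ - algebraMap F Ω c)) :
    ∃ c : F, ∀ θ ∈ s, v (η - algebraMap F Ω c) < v (θ - algebraMap F Ω c) := by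
  classical
  rcases s.eq_empty_or_nonempty with rfl | hne
  · simp
  choose! f hf using hs
  obtain ⟨τ, hτ, hmin⟩ := s.exists_min_image (fun θ => v (η - algebraMap F Ω (f θ))) hne
  refine ⟨f τ, fun θ hθ => ?_⟩
  have h1 : v (algebraMap F Ω (f θ) - algebraMap F Ω (f τ)) < v (θ - algebraMap F Ω (f θ)) := by
    refine lt_of_le_of_lt ?_ (hf θ hθ)
    rw [← sub_sub_sub_cancel_left _ _ η]
    exact v.map_sub_le (hmin θ hθ) le_rfl
  rw [← sub_add_sub_cancel θ (algebraMap F Ω (f θ)), v.map_add_eq_of_lt_left h1]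
  exact (hmin θ hθ).trans_lt (hf θ hθ)

/-- Each quotient `(η - θ) / (c - θ)` differs from `1` by an element of value less than `1`, and
such quotients are closed under products. -/
theorem valuation_prod_sub_prod_lt {c : Ω} (s : Multiset Ω)
    (hs : ∀ θ ∈ s, v (η - c) < v (θ - c)) :
    v ((s.map fun θ => η - θ).prod - (s.map fun θ => c - θ).prod) <
      v (s.map fun θ => c - θ).prod := by
  induction s using Multiset.induction_on with
  | empty => simp
  | cons θ s ih =>
    have h1 := ih fun τ hτ => hs τ (Multiset.mem_cons_of_mem hτ)
    have h2 := hs θ (Multiset.mem_cons_self θ s)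
    rw [Multiset.map_cons, Multiset.map_cons, Multiset.prod_cons, Multiset.prod_cons]
    set A := (s.map fun θ => η - θ).prod
    set B := (s.map fun θ => c - θ).prod
    have hA : v A = v B := by
      rw [← sub_add_cancel A B, v.map_add_eq_of_lt_right h1]
    rw [v.map_sub_swap θ c] at h2
    have h3 : (η - θ) * A - (c - θ) * B = (η - c) * A + (c - θ) * (A - B) := by ring
    rw [h3]
    refine v.map_add_lt ?_ ?_
    · rw [map_mul, map_mul, hA]
      exact mul_lt_mul_of_pos_right h2 (zero_le.trans_lt h1)
    · rw [map_mul, map_mul]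
      exact mul_lt_mul_of_pos_left h1 (zero_le.trans_lt h2)

/-- If `η` has no best approximation in `F`, then values of polynomials at `η` of degree less than
the residue characteristic are approximated by values at elements of `F`. -/
theorem exists_valuation_aeval_sub_lt [IsAlgClosed Ω] [IsGalois F Ω]
    (hv : ∀ (σ : Ω ≃ₐ[F] Ω) (x : Ω), v (σ x) = v x) {p : ℕ}
    (hp : ∀ m : ℕ, m ≠ 0 → m < p → v m = 1)
    (hη : ∀ c : F, ∃ c' : F, v (η - algebraMap F Ω c') < v (η - algebraMap F Ω c))
    {g : F[X]} (hg0 : g ≠ 0) (hg : g.natDegree < p) :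
    ∃ a : F, v (aeval η g - algebraMap F Ω a) < v (algebraMap F Ω a) := by
  classical
  obtain ⟨c, hc⟩ := exists_forall_valuation_sub_lt (F := F) (v := v) (η := η)
    (g.aroots Ω).toFinset fun θ hθ => by
      rw [Multiset.mem_toFinset, mem_aroots] at hθ
      exact exists_valuation_sub_lt_of_natDegree_lt hv hp hη
        ((natDegree_le_of_dvd (minpoly.dvd _ _ hθ.2) hg0).trans_lt hg)
  have h1 := valuation_prod_sub_prod_lt (v := v) (η := η) (c := algebraMap F Ω c) (g.aroots Ω)
    fun θ hθ => hc θ (Multiset.mem_toFinset.2 hθ)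
  have hev : ∀ x : Ω, aeval x g = algebraMap F Ω g.leadingCoeff *
      ((g.aroots Ω).map fun θ => x - θ).prod := fun x => by
    rw [← eval_map_algebraMap, (IsAlgClosed.splits _).eval_eq_prod_roots, leadingCoeff_map]
  refine ⟨g.eval c, ?_⟩
  rw [← aeval_algebraMap_apply_eq_algebraMap_eval, hev, hev, ← mul_sub, map_mul, map_mul]
  refine mul_lt_mul_of_pos_left h1 (v.pos_iff.2 ?_)
  simpa using hg0

end Immediate

/-! ### Immediate extensions and defect -/

section Degrees

variable {F L : Type*} [Field F] [Field L] [Algebra F L] {O : ValuationSubring F}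
  {W : ValuationSubring L}

/-- The hypothesis, shared with `inertiaDegree_eq_one`, says that the extension is immediate: `x`
and `a` have the same value and, for units, the same residue. -/
theorem ramificationIndex_eq_one
    (h : ∀ x : L, x ≠ 0 → ∃ a : F, W.valuation (x - algebraMap F L a) < W.valuation x) :
    ramificationIndex F W = 1 := by
  rw [ramificationIndex, Subgroup.index_eq_one, eq_top_iff]
  rintro γ -
  obtain ⟨x, hx⟩ := W.valuation_surjective (γ : W.ValueGroup)
  have hx0 : x ≠ 0 := by
    rintro rfl
    exact γ.ne_zero (by rw [← hx, map_zero])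
  obtain ⟨a, ha⟩ := h x hx0
  have hva : W.valuation (algebraMap F L a) = W.valuation x := by
    rw [← sub_sub_cancel x (algebraMap F L a), W.valuation.map_sub_eq_of_lt_left ha]
  have ha0 : a ≠ 0 := by
    rintro rfl
    rw [map_zero, map_zero] at hva
    exact hx0 (W.valuation.zero_iff.1 hva.symm)
  refine ⟨Units.mk0 a ha0, Units.ext ?_⟩
  rw [← hx, ← hva]
  rfl

theorem inertiaDegree_eq_one (hW : Extends O W)
    (h : ∀ x : L, x ≠ 0 → ∃ a : F, W.valuation (x - algebraMap F L a) < W.valuation x) :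
    inertiaDegree hW = 1 := by
  let := (residueMap hW).toAlgebra
  have hsurj : Function.Surjective (algebraMap (ResidueField O) (ResidueField W)) := by
    intro y
    obtain ⟨x, rfl⟩ := residue_surjective y
    rcases eq_or_ne (x : L) 0 with hx0 | hx0
    · refine ⟨0, ?_⟩
      rw [map_zero, show x = 0 from Subtype.ext hx0, map_zero]
    obtain ⟨a, ha⟩ := h x hx0
    have hxle : W.valuation (x : L) ≤ 1 := W.valuation_le_one x
    have haO : a ∈ O := by
      rw [← hW.mem_iff, ← W.valuation_le_one_iff, ← sub_sub_cancel (x : L) (algebraMap F L a)]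
      exact W.valuation.map_sub_le hxle (ha.le.trans hxle)
    refine ⟨residue O ⟨a, haO⟩, ?_⟩
    change residueMap hW (residue O ⟨a, haO⟩) = _
    rw [residueMap_residue, eq_comm, ← sub_eq_zero, ← map_sub, residue_eq_zero_iff,
      W.valuation_lt_one_iff]
    exact ha.trans_le hxle
  have e : ResidueField O ≃ₗ[ResidueField O] ResidueField W :=
    LinearEquiv.ofBijective (Algebra.linearMap _ _)
      ⟨(algebraMap (ResidueField O) (ResidueField W)).injective, hsurj⟩
  exact e.finrank_eq.symm.trans (finrank_self _)

theorem IsDefectExtension.not_isDefectlessField {F L : Type u} [Field F] [Field L] [Algebra F L]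
    {O : ValuationSubring F} {W : ValuationSubring L} (h : IsDefectExtension O W) :
    ¬ IsDefectlessField O := by
  intro hO
  obtain ⟨hfin, ⟨hW, huniq⟩, hW', n, hn, hdeg⟩ := h
  have h1 := hO L
  let hu : Unique {W : ValuationSubring L // Extends O W} :=
    ⟨⟨⟨W, hW⟩⟩, fun V => Subtype.ext (huniq V.1 V.2)⟩
  rw [finsum_unique] at h1
  have h2 : finrank F L = ramificationIndex F W * inertiaDegree hW' := h1
  have hpos : 0 < finrank F L := finrank_pos
  rw [← h2] at hdeg
  nlinarith

end Degrees

theorem exists_residue_ne_pow {K : Type*} [Field K] (O : ValuationSubring K) {p : ℕ}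
    (hp : p.Prime) [CharP (ResidueField O) p] (h : ¬ PerfectField (ResidueField O)) :
    ∃ b : O, ∀ c : ResidueField O, c ^ p ≠ residue O b := by
  have : ExpChar (ResidueField O) p := ExpChar.prime hp
  by_contra! hb
  refine h ?_
  have : PerfectRing (ResidueField O) p := PerfectRing.ofSurjective _ p fun y => by
    obtain ⟨x, rfl⟩ := residue_surjective y
    exact hb x
  exact PerfectRing.toPerfectField _ p

theorem valuation_natCast_eq_one {K : Type*} [Field K] (O : ValuationSubring K) {p : ℕ}
    [CharP (ResidueField O) p] {m : ℕ} (hm0 : m ≠ 0) (hm : m < p) :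
    O.valuation (m : K) = 1 := by
  have h1 : residue O (m : O) ≠ 0 := by
    rw [map_natCast, Ne, CharP.cast_eq_zero_iff _ p]
    exact Nat.not_dvd_of_pos_of_lt (Nat.pos_of_ne_zero hm0) hm
  have h2 := (O.valuation_eq_one_iff _).1 ((residue_ne_zero_iff_isUnit _).1 h1)
  simpa using h2

theorem isGalois_adjoin_pow_root {F Ω : Type*} [Field F] [Field Ω] [Algebra F Ω] {p : ℕ}
    (hp : p.Prime) (hζ : (primitiveRoots p F).Nonempty) {b : F} (hb : ∀ c : F, c ^ p ≠ b) {η : Ω}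
    (hη : η ^ p = algebraMap F Ω b) :
    minpoly F η = X ^ p - C b ∧ finrank F (IntermediateField.adjoin F {η}) = p ∧
      IsGalois F (IntermediateField.adjoin F {η}) := by
  have hirr : Irreducible (X ^ p - C b : F[X]) := X_pow_sub_C_irreducible_of_prime hp hb
  have hmin : minpoly F η = X ^ p - C b :=
    (minpoly.eq_of_irreducible_of_monic hirr (by simp [hη])
      (monic_X_pow_sub_C b hp.ne_zero)).symm
  have hinteg : IsIntegral F η := ⟨_, monic_X_pow_sub_C b hp.ne_zero, by simp [hη]⟩
  have hfin := IntermediateField.adjoin.finiteDimensional hinteg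
  have hrank : finrank F (IntermediateField.adjoin F {η}) = p := by
    rw [IntermediateField.adjoin.finrank hinteg, hmin, natDegree_X_pow_sub_C]
  have hsplit := isSplittingField_X_pow_sub_C_of_root_adjoin_eq_top
    (K := F) (L := IntermediateField.adjoin F {η}) (by rwa [hrank]) (a := b)
    (α := IntermediateField.AdjoinSimple.gen F η)
    (by rw [hrank]; exact Subtype.ext hη)
    ((Field.primitive_element_iff_minpoly_natDegree_eq F _).2 (by
      rw [IntermediateField.minpoly_gen, hmin, natDegree_X_pow_sub_C, hrank]))
  rw [hrank] at hsplit
  exact ⟨hmin, hrank, isGalois_of_isSplittingField_X_pow_sub_C hζ hirr _⟩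

end ValuedField

/-! ### The main theorem -/

open ValuedField Polynomial IsLocalRing in
theorem mainTheorem8 {K : Type u} [Field K] [CharZero K] (O : ValuationSubring K)
    (p : ℕ) (hp : 0 < p) [CharP (IsLocalRing.ResidueField O) p]
    (hHens : HenselianLocalRing O)
    (hDefectless : ValuedField.IsDefectlessField O)
    (hDiv : ∀ γ : O.ValueGroupˣ, ∃ δ : O.ValueGroupˣ, δ ^ p = γ)
    (hConv : ValuedField.valueGroupAt O p = ⊤)
    (hImperfect : ¬ PerfectField (IsLocalRing.ResidueField O)) :
    ∃ (F : Type u) (_ : Field F) (_ : Algebra K F) (OF : ValuationSubring F),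
      Algebra.IsAlgebraic K F ∧ ValuedField.Extends O OF ∧
      ¬ ValuedField.IsDefectlessField OF ∧
      ∃ (L : Type u) (_ : Field L) (_ : Algebra F L) (OL : ValuationSubring L),
        IsGalois F L ∧ Module.finrank F L = p ∧ ValuedField.IsDefectExtension OF OL := by
  have hpp : p.Prime := (CharP.char_is_prime_or_zero (ResidueField O) p).resolve_right hp.ne'
  let Ω := AlgebraicClosure K
  obtain ⟨W, hW⟩ := exists_extends Ω O
  obtain ⟨b, hb⟩ := exists_residue_ne_pow O hpp hImperfect
  obtain ⟨F, ⟨ζ, hζF, hζ⟩, hF⟩ :=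
    exists_intermediateField_no_best_approximation hW hpp hDiv hb
  let OF : ValuationSubring F := W.comap (algebraMap F Ω)
  have hOF : Extends O OF := hW
  obtain ⟨η, hη⟩ := IsAlgClosed.exists_pow_nat_eq (algebraMap K Ω b) hpp.pos
  let L := IntermediateField.adjoin F {η}
  let OL : ValuationSubring L := W.comap (algebraMap L Ω)
  have hOLW : Extends OL W := rfl
  have hOL : Extends OF OL := rfl
  -- Automorphisms over `F` are automorphisms over `K`, so henselianity of `K` is enough.
  have hinv : ∀ (σ : Ω ≃ₐ[F] Ω) (x : Ω), W.valuation (σ x) = W.valuation x := fun σ x =>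
    valuation_algEquiv_apply hHens hW (σ.restrictScalars K) x
  have hnat : ∀ m : ℕ, m ≠ 0 → m < p → W.valuation (m : Ω) = 1 := fun m hm0 hm => by
    have := (hW.valuation_eq_iff (m : K) 1).2 (by rw [valuation_natCast_eq_one O hm0 hm, map_one])
    simpa using this
  have hbW : W.valuation (algebraMap K Ω b) ≤ 1 :=
    (W.valuation_le_one_iff _).2 ((hW.mem_iff _).2 b.2)
  have hηW : W.valuation η ≤ 1 := by
    rwa [← pow_le_one_iff hpp.ne_zero, ← map_pow, hη]
  have happ : ∀ c : F, ∃ c' : F, W.valuation (η - algebraMap F Ω c') <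
      W.valuation (η - algebraMap F Ω c) := fun c =>
    exists_valuation_sub_lt_of_pow W.valuation hpp hηW (by rw [hη]; exact hF) c
  have hbF : ∀ c : F, c ^ p ≠ algebraMap K F b := fun c hc => by
    have h1 := (hF c c.2).1
    have h2 : (c : Ω) ^ p = algebraMap K Ω b := congrArg (algebraMap F Ω) hc
    rw [h2, sub_self, map_zero] at h1
    exact not_lt_zero h1
  have hζ' : (primitiveRoots p F).Nonempty :=
    ⟨⟨ζ, hζF⟩, (mem_primitiveRoots hpp.pos).2
      (IsPrimitiveRoot.of_map_of_injective (f := algebraMap F Ω) hζ (algebraMap F Ω).injective)⟩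
  obtain ⟨hmin, hrank, hgal⟩ := isGalois_adjoin_pow_root (Ω := Ω) hpp hζ' hbF hη
  have himm : ∀ x : L, x ≠ 0 → ∃ a : F,
      OL.valuation (x - algebraMap F L a) < OL.valuation x := fun x hx0 => by
    have hinteg : IsIntegral F η := Algebra.IsIntegral.isIntegral η
    obtain ⟨g, hg, hxg⟩ := (IntermediateField.adjoin.powerBasis hinteg).exists_eq_aeval x
    rw [IntermediateField.adjoin.powerBasis_dim, hmin, natDegree_X_pow_sub_C] at hg
    rw [IntermediateField.adjoin.powerBasis_gen] at hxg
    have hg0 : g ≠ 0 := by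
      rintro rfl
      exact hx0 (by rw [hxg, map_zero])
    obtain ⟨a, ha⟩ := exists_valuation_aeval_sub_lt hinv hnat happ hg0 hg
    have hxη : algebraMap L Ω x = aeval η g := by
      rw [hxg, ← aeval_algebraMap_apply]
      rfl
    refine ⟨a, (hOLW.valuation_lt_iff _ _).1 ?_⟩
    rw [map_sub, hxη, ← IsScalarTower.algebraMap_apply F L Ω]
    have : W.valuation (aeval η g) = W.valuation (algebraMap F Ω a) := by
      rw [← sub_add_cancel (aeval η g) (algebraMap F Ω a),
        W.valuation.map_add_eq_of_lt_right ha]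
    rwa [this]
  have hchar : ExpChar (ResidueField OF) p := by
    have : CharP (ResidueField OF) p :=
      charP_of_injective_ringHom (residueMap hOF).injective p
    exact ExpChar.prime hpp
  have hdef : IsDefectExtension OF OL := by
    -- The exponent is `1`: ramification index and inertia degree are both `1`, so the defect is
    -- `p`.
    refine ⟨IntermediateField.adjoin.finiteDimensional (Algebra.IsIntegral.isIntegral η),
      ⟨hOL, fun W' hW' => ?_⟩, hOL, 1, ?_, ?_⟩
    · obtain ⟨V, hV⟩ := exists_extends Ω W'
      have hVW : V = W := extends_unique hHens (hOF.trans (hW'.trans hV)) hW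
      rw [← show V.comap (algebraMap L Ω) = W' from hV, hVW]
    · rw [ringExpChar.eq _ p, pow_one]
      exact hpp.one_lt
    · rw [ringExpChar.eq _ p, ramificationIndex_eq_one himm, inertiaDegree_eq_one hOL himm, pow_one,
        mul_one, mul_one]
      exact hrank
  exact ⟨F, inferInstance, inferInstance, OF, inferInstance, hOF, hdef.not_isDefectlessField,
    L, inferInstance, inferInstance, OL, hgal, hrank, hdef⟩
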